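/- Let $T^2=\mathbb{R}^2/\mathbb{Z}^2$ be the flat torus with the metric $$\rho_T(u,v)=\left[\left(\min\{|x_1-x_2|,\,1-|x_1-x_2|\}\right)^2+\left(\min\{|y_1-y_2|,\,1-|y_1-y_2|\}\right)^2\right]^{1/2}$$ for $u=(x_1,y_1)$, $v=(x_2,y_2)$ with coordinates in $[0,1)$. For $m\geqslant 1$ let $d_m(T^2)$ be the infimum of the positive real numbers $x$ for which there are pairwise disjoint (arbitrary, possibly empty) sets $F_1,\dots,F_m$ with $T^2=F_1\sqcup\dots\sqcup F_m$ and $\operatorname{diam}(F_i)\leqslant x$ for all $i$, where $\operatorname{diam}(F)=\sup_{u,v\in F}\rho_T(u,v)$ (and $\operatorname{diam}(\emptyset)=0$). Then $$d_1(T^2)=d_2(T^2)=\frac{\sqrt2}{2},\qquad d_3(T^2)=\frac{\sqrt{13}}{6}.$$ -/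

import Mathlib

noncomputable section

/-- The flat torus `T² = ℝ²/ℤ²`, as the product of two circles `ℝ/ℤ` of length `1` with the
`ℓ²` product metric, i.e. the metric that comes from the Euclidean metric of the plane. -/
abbrev FlatTorus : Type := WithLp 2 (UnitAddCircle × UnitAddCircle)

/-- The point of the flat torus with coordinates `x`, `y` (taken modulo `1`). -/
def FlatTorus.mk (x y : ℝ) : FlatTorus :=
  WithLp.toLp 2 ((x : UnitAddCircle), (y : UnitAddCircle))

/-- Let `F` be a bounded set in a metric space and `m ≥ 1`. `partitionDiam m F` is the infimum of
the positive reals `x` such that `F` is a disjoint union of `m` sets (arbitrary sets, the empty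
set allowed), each of diameter at most `x`. -/
def partitionDiam {X : Type*} [MetricSpace X] (m : ℕ) (F : Set X) : ℝ :=
  sInf {x : ℝ | 0 < x ∧ ∃ P : Fin m → Set X,
    (∀ i j, i ≠ j → Disjoint (P i) (P j)) ∧ (⋃ i, P i) = F ∧ ∀ i, Metric.diam (P i) ≤ x}

lemma unitAddCircle_dist_coe (x y : ℝ) (hx : x ∈ Set.Ico (0 : ℝ) 1) (hy : y ∈ Set.Ico (0 : ℝ) 1) :
    dist (x : UnitAddCircle) (y : UnitAddCircle) = min |x - y| (1 - |x - y|) := by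
  have h : |x - y| < 1 := by
    rw [abs_lt]; constructor <;> linarith [hx.1, hx.2, hy.1, hy.2]
  rw [dist_eq_norm, ← AddCircle.coe_sub, UnitAddCircle.norm_eq, abs_sub_round_eq_min]
  rcases le_total 0 (x - y) with h0 | h0
  · rw [abs_of_nonneg h0] at h ⊢
    rw [Int.fract_eq_self.mpr ⟨h0, h⟩]
  · rcases h0.eq_or_lt with h1 | h1
    · simp [h1]
    · rw [abs_of_neg h1] at h ⊢
      have : Int.fract (x - y) = x - y + 1 := by
        rw [Int.fract_eq_iff]
        exact ⟨by linarith, by linarith, -1, by push_cast; ring⟩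
      rw [this, min_comm]
      congr 1 <;> ring

/-- The metric of the flat torus in coordinates. -/
lemma FlatTorus.dist_mk (x₁ y₁ x₂ y₂ : ℝ)
    (hx₁ : x₁ ∈ Set.Ico (0 : ℝ) 1) (hy₁ : y₁ ∈ Set.Ico (0 : ℝ) 1)
    (hx₂ : x₂ ∈ Set.Ico (0 : ℝ) 1) (hy₂ : y₂ ∈ Set.Ico (0 : ℝ) 1) :
    dist (FlatTorus.mk x₁ y₁) (FlatTorus.mk x₂ y₂) =
      √((min |x₁ - x₂| (1 - |x₁ - x₂|)) ^ 2 + (min |y₁ - y₂| (1 - |y₁ - y₂|)) ^ 2) := by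
  rw [WithLp.prod_dist_eq_of_L2]
  change √(dist (x₁ : UnitAddCircle) (x₂ : UnitAddCircle) ^ 2 +
    dist (y₁ : UnitAddCircle) (y₂ : UnitAddCircle) ^ 2) = _
  rw [unitAddCircle_dist_coe _ _ hx₁ hx₂, unitAddCircle_dist_coe _ _ hy₁ hy₂]

end

/-! Any two points are within √2/2, and three strips of height 1/3 have diameter at most √(1/4 +
1/9); this gives the upper bounds. For the lower bounds, parts of diameter at most `x` yield a
colouring in which points further apart than `x` differ.

Two colours fail already on the diagonal. For three colours and `x < √13/6`, take a fine grid whose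
neighbours are nearly antipodal points of the torus. The colouring lifts to an integer height with
steps ±1 (`exists_height`). Longer odd jumps are still forbidden pairs, which limits the slope so
much that the height is periodic (`periodic_of_odd_jumps`). The height difference between a point
and its antipode then keeps its sign along the diagonal, yet two such differences add up to 0 around
a full turn (`no_three_coloring`). -/

/-! ### Heights of three-colourings of a periodic grid -/

/-- The representative in `{1, -1}` modulo `3` of the change from the colour `x` to `y ≠ x`. -/
def colorStep (x y : ℤ) : ℤ := if (y - x) % 3 = 1 then 1 else -1

/-- Lift along the bottom row, then up each column. The remaining side of a unit square is a sum of
three steps ±1, hence odd and at most 3 in size; not being a multiple of 3, it is ±1. -/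
lemma exists_height (G : ℕ → ℕ → ℤ) (hrow : ∀ a b, (G (a + 1) b - G a b) % 3 ≠ 0)
    (hcol : ∀ a b, (G a (b + 1) - G a b) % 3 ≠ 0) :
    ∃ H : ℕ → ℕ → ℤ, (∀ a b, (H a b - G a b) % 3 = 0) ∧
      (∀ a b, H (a + 1) b - H a b = 1 ∨ H (a + 1) b - H a b = -1) ∧
      (∀ a b, H a (b + 1) - H a b = 1 ∨ H a (b + 1) - H a b = -1) := by
  let H : ℕ → ℕ → ℤ := fun a b =>
    G 0 0 + ∑ i ∈ Finset.range a, colorStep (G i 0) (G (i + 1) 0)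
      + ∑ j ∈ Finset.range b, colorStep (G a j) (G a (j + 1))
  have h00 : H 0 0 = G 0 0 := by simp [H]
  have hr0 : ∀ a, H (a + 1) 0 - H a 0 = colorStep (G a 0) (G (a + 1) 0) := by
    intro a; simp [H, Finset.sum_range_succ]
  have hc : ∀ a b, H a (b + 1) - H a b = colorStep (G a b) (G a (b + 1)) := by
    intro a b; simp only [H, Finset.sum_range_succ]; ring
  clear_value H
  have hmod0 : ∀ a, (H a 0 - G a 0) % 3 = 0 := by
    intro a
    induction a with
    | zero => simp [h00]
    | succ a ih =>
      have h1 := hr0 a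
      have h2 := hrow a 0
      unfold colorStep at h1
      split_ifs at h1 <;> omega
  have hmod : ∀ a b, (H a b - G a b) % 3 = 0 := by
    intro a b
    induction b with
    | zero => exact hmod0 a
    | succ b ih =>
      have h1 := hc a b
      have h2 := hcol a b
      unfold colorStep at h1
      split_ifs at h1 <;> omega
  have hc' : ∀ a b, H a (b + 1) - H a b = 1 ∨ H a (b + 1) - H a b = -1 := by
    intro a b
    rw [hc]; unfold colorStep; split_ifs <;> simp
  refine ⟨H, hmod, fun a b => ?_, hc'⟩
  induction b with
  | zero => rw [hr0]; unfold colorStep; split_ifs <;> simp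
  | succ b ih =>
    have h1 := hc' a b
    have h2 := hc' (a + 1) b
    have h3 := hrow a (b + 1)
    have h4 := hmod a (b + 1)
    have h5 := hmod (a + 1) (b + 1)
    omega

/-- By the same argument, inductively, each odd jump of length up to `2k+1` changes `F` by only ±1.
So the slope is at most `1/(2k+1)`, and the gain over a period is below 6 in size; it is also a
multiple of 6, hence 0. -/
lemma periodic_of_odd_jumps (k : ℕ) (F : ℕ → ℤ)
    (hstep : ∀ a, F (a + 1) - F a = 1 ∨ F (a + 1) - F a = -1)
    (hper : ∀ a, (F (a + (12 * k + 4)) - F a) % 3 = 0)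
    (hjump : ∀ a i, i ≤ k → (F (a + (2 * i + 1)) - F a) % 3 ≠ 0) (a : ℕ) :
    F (a + (12 * k + 4)) = F a := by
  -- The gain is a multiple of 3 and changes by at most 2 per step.
  have hconst : ∀ a, F (a + (12 * k + 4)) - F a = F (0 + (12 * k + 4)) - F 0 := by
    intro a
    induction a with
    | zero => rfl
    | succ a ih =>
      have h1 := hstep a
      have h2 := hstep (a + (12 * k + 4))
      have h3 := hper a
      have h4 := hper (a + 1)
      rw [show a + 1 + (12 * k + 4) = a + (12 * k + 4) + 1 by ring] at *
      omega
  set W := F (0 + (12 * k + 4)) - F 0 with hW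
  have hparity : ∀ n : ℕ, (F n - F 0 - n) % 2 = 0 := by
    intro n
    induction n with
    | zero => simp
    | succ n ih => have := hstep n; push_cast; omega
  have hjump1 : ∀ i, i ≤ k → ∀ a, |F (a + (2 * i + 1)) - F a| ≤ 1 := by
    intro i
    induction i with
    | zero => intro _ a; rw [abs_le]; have := hstep a; simp; omega
    | succ i ih =>
      intro hi a
      have h1 := ih (by omega) a
      have h2 := hstep (a + (2 * i + 1))
      have h3 := hstep (a + (2 * i + 1) + 1)
      have h4 := hjump a (i + 1) hi
      rw [show a + (2 * (i + 1) + 1) = a + (2 * i + 1) + 1 + 1 by ring] at *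
      have h5 := hparity (a + (2 * i + 1) + 1 + 1)
      have h6 := hparity a
      rw [abs_le] at *
      push_cast at *
      have h7 : (F (a + (2 * i + 1) + 1 + 1) - F a) % 6 = 1 ∨
          (F (a + (2 * i + 1) + 1 + 1) - F a) % 6 = 5 := by omega
      rcases h2 with h2 | h2 <;> rcases h3 with h3 | h3 <;> rcases h7 with h7 | h7 <;> omega
  have hjumps : ∀ n : ℕ, |F (n * (2 * k + 1)) - F 0| ≤ n := by
    intro n
    induction n with
    | zero => simp
    | succ n ih =>
      have h1 := hjump1 k le_rfl (n * (2 * k + 1))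
      rw [show (n + 1) * (2 * k + 1) = n * (2 * k + 1) + (2 * k + 1) by ring]
      rw [abs_le] at *
      push_cast
      omega
  have hperiods : ∀ n : ℕ, F (n * (12 * k + 4)) - F 0 = n * W := by
    intro n
    induction n with
    | zero => simp
    | succ n ih =>
      have h1 := hconst (n * (12 * k + 4))
      rw [show (n + 1) * (12 * k + 4) = n * (12 * k + 4) + (12 * k + 4) by ring]
      push_cast
      linarith
  -- The same stretch is `12k+4` jumps of length `2k+1` and also `2k+1` periods, so `|W| (2k+1) ≤
  -- 12k+4 < 6 (2k+1)`.
  have h1 := hjumps (12 * k + 4)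
  rw [mul_comm, hperiods, abs_le] at h1
  push_cast at h1
  have h2 := hper 0
  have h3 := hparity (0 + (12 * k + 4))
  rw [← hW] at h2 h3
  push_cast at h3
  have h4 : W < 6 := by
    by_contra! h
    have hk : (0 : ℤ) ≤ k := by positivity
    nlinarith [mul_nonneg hk (sub_nonneg.2 h)]
  have h5 : -6 < W := by
    by_contra! h
    have hk : (0 : ℤ) ≤ k := by positivity
    nlinarith [mul_nonneg hk (sub_nonneg.2 h)]
  have h6 := hconst a
  omega

lemma no_three_coloring (k : ℕ) (G : ℕ → ℕ → ℤ)
    (hrow : ∀ a b i, i ≤ k → (G (a + (2 * i + 1)) b - G a b) % 3 ≠ 0)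
    (hcol : ∀ a b i, i ≤ k → (G a (b + (2 * i + 1)) - G a b) % 3 ≠ 0)
    (hperx : ∀ a b, G (a + (12 * k + 4)) b = G a b)
    (hpery : ∀ a b, G a (b + (12 * k + 4)) = G a b)
    (hdiag : ∀ a b, (G (a + (6 * k + 2)) (b + (6 * k + 2)) - G a b) % 3 ≠ 0) : False := by
  obtain ⟨H, hmod, hr, hc⟩ := exists_height G (fun a b => hrow a b 0 (Nat.zero_le _))
    (fun a b => hcol a b 0 (Nat.zero_le _))
  have hH : ∀ a b, H (a + (12 * k + 4)) b = H a b := fun a b =>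
    periodic_of_odd_jumps k (fun a => H a b) (fun a => hr a b)
      (fun a => by
        have h1 := hmod a b
        have h2 := hmod (a + (12 * k + 4)) b
        have h3 := hperx a b
        omega)
      (fun a i hi => by
        have h1 := hmod a b
        have h2 := hmod (a + (2 * i + 1)) b
        have h3 := hrow a b i hi
        omega) a
  have hV : ∀ a b, H a (b + (12 * k + 4)) = H a b := fun a b =>
    periodic_of_odd_jumps k (fun b => H a b) (fun b => hc a b)
      (fun b => by
        have h1 := hmod a b
        have h2 := hmod a (b + (12 * k + 4))
        have h3 := hpery a b
        omega)
      (fun b i hi => by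
        have h1 := hmod a b
        have h2 := hmod a (b + (2 * i + 1))
        have h3 := hcol a b i hi
        omega) b
  have hne : ∀ a b, (H (a + (6 * k + 2)) (b + (6 * k + 2)) - H a b) % 3 ≠ 0 := by
    intro a b
    have h1 := hmod a b
    have h2 := hmod (a + (6 * k + 2)) (b + (6 * k + 2))
    have h3 := hdiag a b
    omega
  have hpr : ∀ a b, (H a b - H 0 b - a) % 2 = 0 := by
    intro a b
    induction a with
    | zero => simp
    | succ n ih => have := hr n b; push_cast; omega
  have hpc : ∀ a b, (H a b - H a 0 - b) % 2 = 0 := by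
    intro a b
    induction b with
    | zero => simp
    | succ n ih => have := hc a n; push_cast; omega
  have heven : ∀ a b, (H (a + (6 * k + 2)) (b + (6 * k + 2)) - H a b) % 2 = 0 := by
    intro a b
    have h1 := hpr a b
    have h2 := hpc 0 b
    have h3 := hpr (a + (6 * k + 2)) (b + (6 * k + 2))
    have h4 := hpc 0 (b + (6 * k + 2))
    push_cast at *
    omega
  have hE : ∀ a b, (H (a + (6 * k + 2)) (b + (6 * k + 2)) - H a b) % 6 = 2 ∨
      (H (a + (6 * k + 2)) (b + (6 * k + 2)) - H a b) % 6 = 4 := by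
    intro a b
    have h1 := hne a b
    have h2 := heven a b
    omega
  -- A grid step changes the antipodal difference by -2, 0 or 2, which cannot carry it past a
  -- multiple of 6, a value it never takes.
  have hstable : ∀ n, (H (n + (6 * k + 2)) (n + (6 * k + 2)) - H n n) / 6
      = (H (0 + (6 * k + 2)) (0 + (6 * k + 2)) - H 0 0) / 6 := by
    intro n
    induction n with
    | zero => rfl
    | succ n ih =>
      rw [← ih]
      have h1 := hr n n
      have h2 := hc (n + 1) n
      have h3 := hr (n + (6 * k + 2)) (n + (6 * k + 2))
      have h4 := hc (n + (6 * k + 2) + 1) (n + (6 * k + 2))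
      have e1 := hE n n
      have e2 := hE (n + 1) n
      have e3 := hE (n + 1) (n + 1)
      rw [show n + 1 + (6 * k + 2) = n + (6 * k + 2) + 1 by ring] at *
      have e4 : (H (n + (6 * k + 2) + 1) (n + (6 * k + 2)) - H (n + 1) n) / 6
          = (H (n + (6 * k + 2)) (n + (6 * k + 2)) - H n n) / 6 := by
        rcases e1 with e1 | e1 <;> rcases e2 with e2 | e2 <;> omega
      rw [← e4]
      rcases e2 with e2 | e2 <;> rcases e3 with e3 | e3 <;> omega
  -- Two half turns make a full period, so the two differences sum to 0. With common quotient `q`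
  -- their sum is `12q` plus 4, 6 or 8, a contradiction.
  have h1 := hstable (6 * k + 2)
  have h2 := hE 0 0
  have h4 := hE (6 * k + 2) (6 * k + 2)
  have h6 := hH 0 0
  have h7 := hV (0 + (12 * k + 4)) 0
  rw [show 6 * k + 2 + (6 * k + 2) = 0 + (12 * k + 4) by ring] at *
  rw [show 0 + (6 * k + 2) = 6 * k + 2 by ring] at *
  omega

/-! ### Distances between nearly antipodal points -/

lemma UnitAddCircle.norm_half_add (s : ℝ) (n : ℤ) (h0 : 0 ≤ s) (h1 : s < 1 / 2) :
    ‖((1 / 2 + s + n : ℝ) : UnitAddCircle)‖ = 1 / 2 - s := by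
  rw [UnitAddCircle.norm_eq, abs_sub_round_eq_min, Int.fract_add_intCast,
    Int.fract_eq_self.mpr ⟨by linarith, by linarith⟩, min_eq_right (by linarith)]
  ring

lemma FlatTorus.dist_mk_half_add (x y s t : ℝ) (m n : ℤ) (hs0 : 0 ≤ s) (hs1 : s < 1 / 2)
    (ht0 : 0 ≤ t) (ht1 : t < 1 / 2) :
    dist (FlatTorus.mk (x + (1 / 2 + s + m)) (y + (1 / 2 + t + n))) (FlatTorus.mk x y) =
      √((1 / 2 - s) ^ 2 + (1 / 2 - t) ^ 2) := by
  rw [WithLp.prod_dist_eq_of_L2]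
  change √(dist ((x + (1 / 2 + s + m) : ℝ) : UnitAddCircle) (x : UnitAddCircle) ^ 2 +
    dist ((y + (1 / 2 + t + n) : ℝ) : UnitAddCircle) (y : UnitAddCircle) ^ 2) = _
  rw [dist_eq_norm, dist_eq_norm, ← AddCircle.coe_sub, ← AddCircle.coe_sub, add_sub_cancel_left,
    add_sub_cancel_left, UnitAddCircle.norm_half_add s m hs0 hs1,
    UnitAddCircle.norm_half_add t n ht0 ht1]

lemma FlatTorus.mk_add_int (x y : ℝ) (m n : ℤ) :
    FlatTorus.mk (x + m) (y + n) = FlatTorus.mk x y := by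
  have h : ∀ (x : ℝ) (m : ℤ), ((x + m : ℝ) : UnitAddCircle) = (x : UnitAddCircle) := by
    intro x m
    simp
  unfold FlatTorus.mk
  rw [h, h]

lemma FlatTorus.dist_le_sqrt_two_div_two (u v : FlatTorus) : dist u v ≤ √2 / 2 := by
  rw [WithLp.prod_dist_eq_of_L2, dist_eq_norm, dist_eq_norm]
  have h1 : ‖u.fst - v.fst‖ ≤ 1 / 2 := by
    simpa using AddCircle.norm_le_half_period (1 : ℝ) one_ne_zero
  have h2 : ‖u.snd - v.snd‖ ≤ 1 / 2 := by
    simpa using AddCircle.norm_le_half_period (1 : ℝ) one_ne_zero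
  have h3 : √2 / 2 = √(1 / 2) := by
    rw [eq_comm, Real.sqrt_eq_iff_mul_self_eq (by norm_num) (by positivity)]
    nlinarith [Real.sq_sqrt (show (0 : ℝ) ≤ 2 by norm_num)]
  rw [h3]
  apply Real.sqrt_le_sqrt
  nlinarith [norm_nonneg (u.fst - v.fst), norm_nonneg (u.snd - v.snd)]

/-- A cover of the flat torus by sets of diameter at most `x` gives a colouring in which points
at distance more than `x` have different colours. -/
lemma FlatTorus.exists_coloring {m : ℕ} {x : ℝ} {P : Fin m → Set FlatTorus}
    (hcover : (⋃ i, P i) = Set.univ) (hdiam : ∀ i, Metric.diam (P i) ≤ x) :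
    ∃ c : FlatTorus → Fin m, ∀ u v, x < dist u v → c u ≠ c v := by
  have h : ∀ u, ∃ i, u ∈ P i := fun u => by
    rw [← Set.mem_iUnion, hcover]
    exact Set.mem_univ u
  choose c hc using h
  refine ⟨c, fun u v huv heq => ?_⟩
  have hb : Bornology.IsBounded (P (c u)) := Metric.isBounded_iff.2
    ⟨√2 / 2, fun _ _ _ _ => FlatTorus.dist_le_sqrt_two_div_two _ _⟩
  have := Metric.dist_le_diam_of_mem hb (hc u) (heq ▸ hc v)
  linarith [hdiam (c u)]

/-! ### Lower bounds from colourings -/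

lemma FlatTorus.sqrt_two_div_two_le_of_two_coloring {x : ℝ} (c : FlatTorus → Fin 2)
    (hc : ∀ u v, x < dist u v → c u ≠ c v) : √2 / 2 ≤ x := by
  by_contra! hx
  have h2 : (0 : ℝ) < √2 := by positivity
  have h22 : √2 ^ 2 = 2 := Real.sq_sqrt (by norm_num)
  obtain ⟨n, hn⟩ := exists_nat_gt (1 / (√2 / 2 - x))
  have hn0 : (0 : ℝ) < n := lt_trans (by have := sub_pos.2 hx; positivity) hn
  set h : ℝ := 1 / (2 * (n + 1)) with hh
  have hpos : 0 < h := by positivity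
  have hlt : h < 1 / 2 := by
    rw [hh, div_lt_div_iff₀ (by positivity) (by norm_num)]; linarith
  have hsqrt : ∀ s : ℝ, 0 ≤ s → s < 1 / 2 →
      √((1 / 2 - s) ^ 2 + (1 / 2 - s) ^ 2) = √2 * (1 / 2 - s) := by
    intro s hs0 hs1
    rw [Real.sqrt_eq_iff_mul_self_eq (by positivity)
      (mul_nonneg h2.le (by linarith))]
    nlinarith
  have hhx : x < √2 * (1 / 2 - h) := by
    rw [div_lt_iff₀ (sub_pos.2 hx)] at hn
    have h3 : h * (2 * (n + 1)) = 1 := by rw [hh]; field_simp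
    have h4 : √2 ≤ 2 := by nlinarith
    have h5 : 2 * h < √2 / 2 - x := by
      by_contra! h6
      nlinarith
    nlinarith
  have hanti : ∀ a s : ℝ, 0 ≤ s → s ≤ h →
      c (FlatTorus.mk (a + (1 / 2 + s)) (a + (1 / 2 + s))) ≠ c (FlatTorus.mk a a) := by
    intro a s hs0 hs1
    apply hc
    have h3 := FlatTorus.dist_mk_half_add a a s s 0 0 hs0 (by linarith) hs0 (by linarith)
    rw [hsqrt s hs0 (by linarith)] at h3
    simp only [Int.cast_zero, add_zero] at h3
    rw [h3]
    nlinarith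
  have hconst : ∀ j : ℕ, c (FlatTorus.mk (j * h) (j * h)) = c (FlatTorus.mk 0 0) := by
    intro j
    induction j with
    | zero => simp
    | succ j ih =>
      rw [← ih]
      -- Consecutive diagonal points both conflict with the exact antipode of the second, so with
      -- two colours they agree. After `n + 1` steps this reaches 1/2, the antipode of 0.
      have h3 := hanti (j * h) h hpos.le le_rfl
      have h4 := hanti ((j + 1 : ℕ) * h) 0 le_rfl hpos.le
      rw [show ((j + 1 : ℕ) * h + (1 / 2 + 0) : ℝ) = j * h + (1 / 2 + h) by push_cast; ring] at h4
      omega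
  have h3 := hconst (n + 1)
  rw [show ((n + 1 : ℕ) * h : ℝ) = 0 + (1 / 2 + 0) by rw [hh]; push_cast; field_simp; ring] at h3
  exact hanti 0 0 le_rfl hpos.le h3

lemma FlatTorus.sqrt_thirteen_div_six_le_of_three_coloring {x : ℝ} (c : FlatTorus → Fin 3)
    (hc : ∀ u v, x < dist u v → c u ≠ c v) : √13 / 6 ≤ x := by
  by_contra! hx
  have h13 : √13 / 6 = √((1 / 2 - 1 / 6) ^ 2 + (1 / 2) ^ 2) := by
    rw [eq_comm, Real.sqrt_eq_iff_mul_self_eq (by norm_num) (by positivity)]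
    nlinarith [Real.sq_sqrt (show (0 : ℝ) ≤ 13 by norm_num)]
  have hlim : Filter.Tendsto (fun t : ℝ => √((1 / 2 - t) ^ 2 + (1 / 2) ^ 2)) (nhds (1 / 6))
      (nhds (√13 / 6)) := by
    rw [h13]
    exact Continuous.tendsto (by fun_prop) _
  obtain ⟨ε, hε, hball⟩ := Metric.mem_nhds_iff.1 (hlim.eventually (lt_mem_nhds hx))
  obtain ⟨k, hk⟩ := exists_nat_gt (1 / ε)
  have hk0 : (0 : ℝ) < k := lt_trans (by positivity) hk
  -- The longest jump is `(2k+1)h = 1/6 + h/3`, so its distance is close to √13/6, while a full turn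
  -- and a half turn are whole numbers of steps.
  set h : ℝ := 1 / (12 * k + 4) with hh
  have hpos : 0 < h := by positivity
  have hmul : h * (12 * k + 4) = 1 := by rw [hh]; field_simp
  have hjump : (2 * k + 1) * h < 1 / 2 ∧ x < √((1 / 2 - (2 * k + 1) * h) ^ 2 + (1 / 2) ^ 2) := by
    refine ⟨by nlinarith, hball ?_⟩
    rw [div_lt_iff₀ hε] at hk
    rw [Metric.mem_ball, Real.dist_eq, abs_lt]
    constructor <;> nlinarith
  have hshort : ∀ s : ℝ, s ≤ (2 * k + 1) * h → x < √((1 / 2 - s) ^ 2 + (1 / 2) ^ 2) := by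
    intro s hs
    refine hjump.2.trans_le (Real.sqrt_le_sqrt ?_)
    nlinarith [hjump.1]
  have hfin : ∀ i j : Fin 3, i ≠ j → ((i.val : ℤ) - (j.val : ℤ)) % 3 ≠ 0 := by
    intro i j hij; omega
  have hodd : ∀ i : ℕ, i ≤ k → (2 * i + 1 : ℝ) * h ≤ (2 * k + 1) * h := by
    intro i hi
    have : (i : ℝ) ≤ k := by exact_mod_cast hi
    gcongr
  -- The term `(a + b) / 2` adds half a turn in both coordinates at every step, so an odd jump in
  -- one direction lands near the antipode, and an even one adds only whole turns to the drift by
  -- multiples of `h`.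
  refine no_three_coloring k (fun a b : ℕ => ((c (FlatTorus.mk (a * h + (a + b) / 2)
    (b * h + (a + b) / 2))).val : ℤ)) ?_ ?_ ?_ ?_ ?_
  · intro a b i hi
    apply hfin
    apply hc
    have h1 := hodd i hi
    have h2 := FlatTorus.dist_mk_half_add (a * h + (a + b) / 2) (b * h + (a + b) / 2)
      ((2 * i + 1) * h) 0 i i (by positivity) (by linarith [hjump.1]) le_rfl (by norm_num)
    rw [sub_zero] at h2
    refine (hshort _ h1).trans_eq (h2.symm.trans ?_)
    congr 2 <;> push_cast <;> ring
  · intro a b i hi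
    apply hfin
    apply hc
    have h1 := hodd i hi
    have h2 := FlatTorus.dist_mk_half_add (a * h + (a + b) / 2) (b * h + (a + b) / 2)
      0 ((2 * i + 1) * h) i i le_rfl (by norm_num) (by positivity) (by linarith [hjump.1])
    rw [sub_zero, add_comm ((1 / 2 : ℝ) ^ 2)] at h2
    refine (hshort _ h1).trans_eq (h2.symm.trans ?_)
    congr 2 <;> push_cast <;> ring
  · intro a b
    have h1 := FlatTorus.mk_add_int (a * h + (a + b) / 2) (b * h + (a + b) / 2)
      (6 * k + 3) (6 * k + 2)
    rw [← h1]
    congr 4 <;> push_cast <;> linarith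
  · intro a b
    have h1 := FlatTorus.mk_add_int (a * h + (a + b) / 2) (b * h + (a + b) / 2)
      (6 * k + 2) (6 * k + 3)
    rw [← h1]
    congr 4 <;> push_cast <;> linarith
  · intro a b
    apply hfin
    apply hc
    have h2 := FlatTorus.dist_mk_half_add (a * h + (a + b) / 2) (b * h + (a + b) / 2)
      0 0 (6 * k + 2) (6 * k + 2) le_rfl (by norm_num) le_rfl (by norm_num)
    have h3 := hshort 0 (by positivity)
    rw [sub_zero] at h2 h3
    refine h3.trans_eq (h2.symm.trans ?_)
    congr 2 <;> push_cast <;> linarith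

/-! ### Upper bounds and conclusion -/

lemma FlatTorus.exists_three_strips : ∃ P : Fin 3 → Set FlatTorus,
    (∀ i j, i ≠ j → Disjoint (P i) (P j)) ∧ (⋃ i, P i) = Set.univ ∧
      ∀ i, Metric.diam (P i) ≤ √13 / 6 := by
  have hrep : ∀ y : UnitAddCircle, ∃ t : ℝ, 0 ≤ t ∧ t < 1 ∧ (t : UnitAddCircle) = y := by
    intro y
    obtain ⟨t, ht, rfl⟩ := (AddCircle.coe_image_Ico_eq (1 : ℝ) 0).symm ▸ Set.mem_univ y
    exact ⟨t, ht.1, by linarith [ht.2], rfl⟩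
  choose r hr0 hr1 hr using hrep
  refine ⟨fun i => {u | ⌊3 * r u.snd⌋ = (i.val : ℤ)}, fun i j hij => ?_, ?_, fun i => ?_⟩
  · rw [Set.disjoint_left]
    intro u hi hj
    simp only [Set.mem_ofPred_eq] at hi hj
    omega
  · rw [Set.eq_univ_iff_forall]
    intro u
    have h0 : 0 ≤ ⌊3 * r u.snd⌋ := Int.floor_nonneg.2 (by linarith [hr0 u.snd])
    have h1 : ⌊3 * r u.snd⌋ < 3 := Int.floor_lt.2 (by push_cast; linarith [hr1 u.snd])
    rw [Set.mem_iUnion]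
    exact ⟨⟨⌊3 * r u.snd⌋.toNat, by omega⟩, by simp only [Set.mem_ofPred_eq]; omega⟩
  · refine Metric.diam_le_of_forall_dist_le (by positivity) fun u hu v hv => ?_
    have h13 : √13 / 6 = √((1 / 2) ^ 2 + (1 / 3) ^ 2) := by
      rw [eq_comm, Real.sqrt_eq_iff_mul_self_eq (by norm_num) (by positivity)]
      nlinarith [Real.sq_sqrt (show (0 : ℝ) ≤ 13 by norm_num)]
    rw [WithLp.prod_dist_eq_of_L2, h13]
    apply Real.sqrt_le_sqrt
    have h1 : dist u.fst v.fst ≤ 1 / 2 := by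
      rw [dist_eq_norm]
      simpa using AddCircle.norm_le_half_period (1 : ℝ) one_ne_zero
    have h2 : dist u.snd v.snd ≤ 1 / 3 := by
      have h3 := Int.abs_sub_lt_one_of_floor_eq_floor (hu.trans hv.symm)
      rw [← hr u.snd, ← hr v.snd, unitAddCircle_dist_coe _ _ ⟨hr0 _, hr1 _⟩ ⟨hr0 _, hr1 _⟩]
      refine (min_le_left _ _).trans ?_
      rw [← mul_sub, abs_mul, abs_of_pos three_pos] at h3
      linarith
    gcongr

lemma partitionDiam_eq {X : Type*} [MetricSpace X] {m : ℕ} {F : Set X} {d : ℝ} (hd : 0 < d)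
    (hex : ∃ P : Fin m → Set X, (∀ i j, i ≠ j → Disjoint (P i) (P j)) ∧ (⋃ i, P i) = F ∧
      ∀ i, Metric.diam (P i) ≤ d)
    (hlow : ∀ x, ∀ P : Fin m → Set X, (⋃ i, P i) = F → (∀ i, Metric.diam (P i) ≤ x) → d ≤ x) :
    partitionDiam m F = d :=
  IsLeast.csInf_eq ⟨⟨hd, hex⟩, fun _ ⟨_, P, _, hP, hx⟩ => hlow _ P hP hx⟩

theorem theorem2 :
    partitionDiam 1 (Set.univ : Set FlatTorus) = √2 / 2 ∧
    partitionDiam 2 (Set.univ : Set FlatTorus) = √2 / 2 ∧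
    partitionDiam 3 (Set.univ : Set FlatTorus) = √13 / 6 := by
  have hdiam : ∀ S : Set FlatTorus, Metric.diam S ≤ √2 / 2 := fun S =>
    Metric.diam_le_of_forall_dist_le (by positivity)
      fun u _ v _ => FlatTorus.dist_le_sqrt_two_div_two u v
  refine ⟨partitionDiam_eq (by positivity) ⟨fun _ => Set.univ, fun i j hij => ?_, ?_,
      fun _ => hdiam _⟩ fun x P hP hx => ?_,
    partitionDiam_eq (by positivity) ⟨![Set.univ, ∅], fun i j hij => ?_, ?_,
      fun _ => hdiam _⟩ fun x P hP hx => ?_,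
    partitionDiam_eq (by positivity) FlatTorus.exists_three_strips fun x P hP hx => ?_⟩
  · exact absurd (Subsingleton.elim i j) hij
  · exact Set.iUnion_const _
  · obtain ⟨c, hc⟩ := FlatTorus.exists_coloring hP hx
    -- A one-colouring is a two-colouring with one colour unused.
    exact FlatTorus.sqrt_two_div_two_le_of_two_coloring (fun u => (c u).castLE one_le_two)
      fun u v huv => absurd (Subsingleton.elim _ _) (hc u v huv)
  · fin_cases i <;> fin_cases j <;> simp at hij ⊢
  · rw [Set.eq_univ_iff_forall]
    exact fun u => Set.mem_iUnion.2 ⟨0, Set.mem_univ u⟩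
  · obtain ⟨c, hc⟩ := FlatTorus.exists_coloring hP hx
    exact FlatTorus.sqrt_two_div_two_le_of_two_coloring c hc
  · obtain ⟨c, hc⟩ := FlatTorus.exists_coloring hP hx
    exact FlatTorus.sqrt_thirteen_div_six_le_of_three_coloring c hc
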